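/- Theorem (Solovay). There exists a set $A\subseteq\mathbb{N}$ that is computably enumerable, undecidable and $K$-trivial; moreover, $A$ can be chosen to be simple in Post's sense, i.e. $A$ is computably enumerable, its complement $\mathbb{N}\setminus A$ is infinite, and $A\cap W\neq\emptyset$ for every infinite computably enumerable set $W\subseteq\mathbb{N}$. Here $A$ is identified with its characteristic sequence $a_0a_1a_2\ldots$ ($a_i=1$ if $i\in A$ and $a_i=0$ otherwise), and a binary sequence $a_0a_1a_2\ldots$ is called $K$-trivial if $$K(a_0a_1\ldots a_{n-1})=K(n)+O(1),$$ that is, if there is a constant $c$ with $|K(a_0a_1\ldots a_{n-1})-K(n)|\le c$ for all $n\ge 0$. $K$ denotes prefix Kolmogorov complexity: a prefix-free decompressor is a partial computable function $D$ from binary strings to finite objects (binary strings and natural numbers, coded by natural numbers in a fixed computable way) such that no string in the domain of $D$ is a proper prefix of another one; $K_D(x)$ is the minimal length of a string $p$ with $D(p)=x$ ($\infty$ if there is none); $D$ is optimal if for every prefix-free decompressor $D'$ there is a constant $c$ with $K_D(x)\le K_{D'}(x)+c$ for all $x$; and $K=K_U$ for an optimal $U$. Optimal prefix-free decompressors exist,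 and the notion of $K$-triviality does not depend on the choice of $U$. -/

import Mathlib

namespace KTriviality

/-- A prefix-free decompressor: a partial computable map from binary strings (programs) to
finite objects, coded by natural numbers, no program in its domain being a proper prefix of
another one. -/
structure IsPrefixDecompressor (D : List Bool →. ℕ) : Prop where
  partrec : Partrec D
  prefixFree : ∀ p q : List Bool, (D p).Dom → (D q).Dom → p <+: q → p = q

/-- The complexity of the finite object `x` with respect to `D`: the minimal length of a program
on which `D` outputs (the code of) `x`, and `⊤` if there is no such program. -/
noncomputable def complexity {α : Type*} [Encodable α] (D : List Bool →. ℕ) (x : α) : ℕ∞ :=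
  ⨅ (p : List Bool) (_ : Encodable.encode x ∈ D p), (p.length : ℕ∞)

/-- An optimal prefix-free decompressor: its complexity function is minimal up to an additive
constant. Prefix complexity is `complexity U` for such a `U`. -/
structure IsOptimal (U : List Bool →. ℕ) : Prop where
  isPrefixDecompressor : IsPrefixDecompressor U
  le_add : ∀ D : List Bool →. ℕ, IsPrefixDecompressor D →
    ∃ c : ℕ, ∀ x : ℕ, complexity U x ≤ complexity D x + c

/-- The prefix `a₀ a₁ … aₙ₋₁` of an infinite binary sequence. -/
def initialSegment (a : ℕ → Bool) (n : ℕ) : List Bool := (List.range n).map a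

/-- A binary sequence `a` is K-trivial if `K(a₀ … aₙ₋₁) = K(n) + O(1)`, where `K` is prefix
complexity. By `IsKTrivial.of_isOptimal` the choice of the optimal decompressor is immaterial. -/
def IsKTrivial (a : ℕ → Bool) : Prop :=
  ∃ U : List Bool →. ℕ, IsOptimal U ∧ ∃ c : ℕ, ∀ n : ℕ,
    complexity U (initialSegment a n) ≤ complexity U n + c ∧
    complexity U n ≤ complexity U (initialSegment a n) + c

open Classical in
/-- The characteristic sequence of a set of natural numbers. -/
noncomputable def charSeq (A : Set ℕ) : ℕ → Bool := fun i => decide (i ∈ A)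

/-- Computably enumerable sets of natural numbers. -/
def IsEnumerable (A : Set ℕ) : Prop := REPred (fun i => i ∈ A)

/-- Decidable (computable) sets of natural numbers. -/
def IsDecidable (A : Set ℕ) : Prop := ComputablePred (fun i => i ∈ A)

/-- Simple sets in the sense of Post. -/
structure IsSimple (A : Set ℕ) : Prop where
  isEnumerable : IsEnumerable A
  infinite_compl : Aᶜ.Infinite
  inter_nonempty : ∀ W : Set ℕ, IsEnumerable W → W.Infinite → (W ∩ A).Nonempty

theorem IsOptimal.exists_le_add {U V : List Bool →. ℕ} (hU : IsOptimal U) (hV : IsOptimal V) :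
    ∃ c : ℕ, ∀ {α : Type} [Encodable α] (x : α), complexity U x ≤ complexity V x + c := by
  obtain ⟨c, hc⟩ := hU.le_add V hV.isPrefixDecompressor
  exact ⟨c, fun x => by simpa [complexity] using hc (Encodable.encode x)⟩

/-- K-triviality does not depend on the choice of the optimal decompressor. -/
theorem IsKTrivial.of_isOptimal {a : ℕ → Bool} (ha : IsKTrivial a) {V : List Bool →. ℕ}
    (hV : IsOptimal V) : ∃ c : ℕ, ∀ n : ℕ,
    complexity V (initialSegment a n) ≤ complexity V n + c ∧
    complexity V n ≤ complexity V (initialSegment a n) + c := by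
  obtain ⟨U, hU, c, h⟩ := ha
  obtain ⟨d, hd⟩ := hU.exists_le_add hV
  obtain ⟨e, he⟩ := hV.exists_le_add hU
  refine ⟨d + c + e, fun n => ⟨?_, ?_⟩⟩
  · calc complexity V (initialSegment a n) ≤ complexity U (initialSegment a n) + e := he _
      _ ≤ complexity U n + c + e := by gcongr; exact (h n).1
      _ ≤ complexity V n + d + c + e := by gcongr; exact hd n
      _ = complexity V n + ((d + c + e : ℕ) : ℕ∞) := by push_cast; simp only [add_assoc]
  · calc complexity V n ≤ complexity U n + e := he _
      _ ≤ complexity U (initialSegment a n) + c + e := by gcongr; exact (h n).2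
      _ ≤ complexity V (initialSegment a n) + d + c + e := by gcongr; exact hd _
      _ = complexity V (initialSegment a n) + ((d + c + e : ℕ) : ℕ∞) := by
        push_cast; simp only [add_assoc]

end KTriviality

open Nat.Partrec (Code)
open Encodable Denumerable

namespace KTriviality

/-! Fix an optimal `U` and enumerate its programs as pairs (length, output); call this enumeration
`g`. The cost of putting x into the set A at step s is the total weight 2^(-length) of the pairs
listed before s whose output exceeds x: these are the lengths n whose initial segment changes and
must be described anew. Requirement e waits for an element x ≥ 2e of the e-th c.e. set whose cost is
at most 2^(-e-1), puts it in, and never acts again. Each requirement acts at most once, so the total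
cost is at most 1.

Simplicity: by Kraft's inequality (`sum_pow_length_le_one`) the total weight converges, so large
numbers have arbitrarily small cost and every infinite c.e. set gets hit
(`inter_solovaySet_nonempty`). The bound x ≥ 2e leaves infinitely many numbers outside
(`infinite_compl_solovaySet`). Undecidability follows from simplicity.

K-triviality: each listed program for n yields a request, one bit longer, for the current initial
segment of length n, and a fresh request whenever that segment changes. The extra bit halves all
weights: the first requests weigh at most 1/2, and the repeated ones at most half the total cost
(`sum_weight_request_le_one`). Kraft–Chaitin (`exists_isPrefixDecompressor_of_requests`) turns the
requests into a decompressor, and the request that names the final segment (`exists_request`) gives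
K(a₀…aₙ₋₁) ≤ K(n) + O(1). The converse inequality holds because n is computable from the segment. -/

/-! ### Step-by-step enumeration of graphs of partial computable maps -/

/-- The `t`-th step of an enumeration of the graph of the partial map on binary strings computed
by the code `c`; every program is listed at most once. -/
def graphEnum (c : Code) (t : ℕ) : Option (List Bool × ℕ) :=
  (decode₂ (List Bool) t.unpair.1).bind fun p =>
    if (c.evaln (t.unpair.2 - 1) t.unpair.1).isSome = true then none
    else (c.evaln t.unpair.2 t.unpair.1).map (Prod.mk p)

theorem primrec_graphEnum : Primrec₂ graphEnum := by
  have ht1 : Primrec fun a : Code × ℕ => a.2.unpair.1 := Primrec.fst.comp (Primrec.unpair.comp .snd)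
  have ht2 : Primrec fun a : Code × ℕ => a.2.unpair.2 := Primrec.snd.comp (Primrec.unpair.comp .snd)
  have h1 : Primrec fun a : Code × ℕ => a.1.evaln a.2.unpair.2 a.2.unpair.1 :=
    Code.primrec_evaln.comp (.pair (.pair ht2 .fst) ht1)
  have h2 : Primrec fun a : Code × ℕ => a.1.evaln (a.2.unpair.2 - 1) a.2.unpair.1 :=
    Code.primrec_evaln.comp (.pair (.pair (Primrec.nat_sub.comp ht2 (.const 1)) .fst) ht1)
  refine Primrec.option_bind (Primrec.decode₂.comp ht1) (.mk (Primrec.ite ?_ (.const none) ?_))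
  · exact Primrec.eq.comp ((Primrec.option_isSome.comp h2).comp .fst) (.const true)
  · exact Primrec.option_map (h1.comp .fst) (.mk (.pair (Primrec.snd.comp .fst) .snd))

theorem graphEnum_eq_some {c : Code} {t n : ℕ} {p : List Bool} :
    graphEnum c t = some (p, n) ↔ encode p = t.unpair.1 ∧
      c.evaln t.unpair.2 t.unpair.1 = some n ∧
      ¬ (c.evaln (t.unpair.2 - 1) t.unpair.1).isSome = true := by
  rw [graphEnum, Option.bind_eq_some_iff]
  constructor
  · rintro ⟨q, hq, h⟩
    split_ifs at h with hs
    obtain ⟨m, hm, e⟩ := Option.map_eq_some_iff.1 h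
    obtain ⟨rfl, rfl⟩ := Prod.mk.inj e
    exact ⟨decode₂_eq_some.1 hq, hm, hs⟩
  · rintro ⟨hp, hn, hs⟩
    exact ⟨p, decode₂_eq_some.2 hp, by rw [if_neg hs, hn, Option.map_some]⟩

theorem mem_eval_of_graphEnum {c : Code} {t n : ℕ} {p : List Bool}
    (h : graphEnum c t = some (p, n)) : n ∈ c.eval (encode p) := by
  obtain ⟨hp, hn, -⟩ := graphEnum_eq_some.1 h
  rw [hp]
  exact Code.evaln_sound hn

theorem exists_graphEnum {c : Code} {n : ℕ} {p : List Bool} (h : n ∈ c.eval (encode p)) :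
    ∃ t, graphEnum c t = some (p, n) := by
  classical
  have hex := Code.evaln_complete.1 h
  refine ⟨Nat.pair (encode p) (Nat.find hex), ?_⟩
  have hspec : c.evaln (Nat.find hex) (encode p) = some n := Nat.find_spec hex
  have hpos : Nat.find hex ≠ 0 := fun h0 => by simp [h0, Code.evaln] at hspec
  rw [graphEnum_eq_some, Nat.unpair_pair]
  refine ⟨rfl, hspec, fun hs => ?_⟩
  obtain ⟨m, hm⟩ := Option.isSome_iff_exists.1 hs
  have := Code.evaln_mono (Nat.sub_le _ 1) hm
  rw [Option.mem_def, hspec] at this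
  exact Nat.find_min hex (Nat.sub_lt (Nat.pos_of_ne_zero hpos) one_pos)
    (by rw [Option.mem_def, hm, this])

/-- A step lists a program only if its second component is the least sufficient evaluation bound; by
monotonicity of `evaln` that bound is unique. -/
theorem graphEnum_inj {c : Code} {t t' n n' : ℕ} {p : List Bool}
    (h : graphEnum c t = some (p, n)) (h' : graphEnum c t' = some (p, n')) : t = t' := by
  obtain ⟨hp, hn, hs⟩ := graphEnum_eq_some.1 h
  obtain ⟨hp', hn', hs'⟩ := graphEnum_eq_some.1 h'
  have e : t.unpair.1 = t'.unpair.1 := hp.symm.trans hp'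
  have key : ∀ {k k' i m}, c.evaln k i = some m →
      ¬ (c.evaln (k' - 1) i).isSome = true → k' ≤ k := by
    intro k k' i m hk hk'
    by_contra hlt
    exact hk' (Option.isSome_iff_exists.2 ⟨m, Code.evaln_mono (by omega) hk⟩)
  have e' : t.unpair.2 = t'.unpair.2 :=
    le_antisymm (key (e ▸ hn') (e ▸ hs)) (key hn (e ▸ hs'))
  rw [← Nat.pair_unpair t, ← Nat.pair_unpair t', e, e']

theorem length_le_of_graphEnum {c : Code} {t n : ℕ} {p : List Bool}
    (h : graphEnum c t = some (p, n)) : p.length ≤ t :=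
  (length_le_encode p).trans ((graphEnum_eq_some.1 h).1 ▸ Nat.unpair_left_le t)

theorem exists_code_of_partrec {D : List Bool →. ℕ} (hD : Partrec D) :
    ∃ c : Code, ∀ p, c.eval (encode p) = D p := by
  obtain ⟨c, hc⟩ := Code.exists_code.1 hD
  refine ⟨c, fun p => ?_⟩
  rw [hc]
  simp only [encodek, Part.coe_some, Part.bind_some]
  exact Part.map_id' (fun _ => rfl) _

/-- A computable enumeration of (program, output) pairs with pairwise incomparable programs is
contained in the graph of a prefix-free decompressor. -/
theorem exists_isPrefixDecompressor {h : ℕ → Option (List Bool × ℕ)} (hc : Computable h)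
    (hpf : ∀ t t' p p' n n', h t = some (p, n) → h t' = some (p', n') → p <+: p' → t = t') :
    ∃ D, IsPrefixDecompressor D ∧ ∀ t p n, h t = some (p, n) → n ∈ D p := by
  let f : List Bool → ℕ → Option ℕ := fun q t =>
    (h t).bind fun a => if a.1 = q then some a.2 else none
  have hf : ∀ q t n, n ∈ f q t ↔ h t = some (q, n) := by
    intro q t n
    simp only [f, Option.mem_def, Option.bind_eq_some_iff, Prod.exists]
    constructor
    · rintro ⟨p, m, e, e'⟩
      by_cases hpq : p = q
      · subst hpq
        rw [if_pos rfl] at e'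
        rw [e, Option.some.inj e']
      · rw [if_neg hpq] at e'
        cases e'
    · exact fun e => ⟨q, n, e, by simp⟩
  have hmem : ∀ q n, n ∈ Nat.rfindOpt (f q) → ∃ t, h t = some (q, n) := fun q n hn =>
    (Nat.rfindOpt_spec hn).imp fun t ht => (hf q t n).1 ht
  refine ⟨fun q => Nat.rfindOpt (f q), ⟨Partrec.rfindOpt ?_, ?_⟩, ?_⟩
  · have hg : Primrec fun a : (List Bool × ℕ) × (List Bool × ℕ) =>
        if a.2.1 = a.1.1 then some a.2.2 else none :=
      Primrec.ite (Primrec.eq.comp (Primrec.fst.comp .snd) (Primrec.fst.comp .fst))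
        (Primrec.option_some.comp (Primrec.snd.comp .snd)) (.const none)
    exact Computable.option_bind (f := fun a : List Bool × ℕ => h a.2)
      (g := fun a b => if b.1 = a.1 then some b.2 else none) (hc.comp .snd) hg.to_comp
  · intro p q hp hq hpq
    obtain ⟨t, ht⟩ := hmem p _ (Part.get_mem hp)
    obtain ⟨t', ht'⟩ := hmem q _ (Part.get_mem hq)
    obtain rfl := hpf _ _ _ _ _ _ ht ht' hpq
    rw [ht] at ht'
    exact (Prod.mk.inj (Option.some.inj ht')).1
  · intro t p n ht
    have hd : (Nat.rfindOpt (f p)).Dom := Nat.rfindOpt_dom.2 ⟨t, n, (hf p t n).2 ht⟩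
    obtain ⟨t', ht'⟩ := hmem p _ (Part.get_mem hd)
    obtain rfl := hpf _ _ _ _ _ _ ht ht' (List.prefix_refl p)
    rw [ht] at ht'
    rw [(Prod.mk.inj (Option.some.inj ht')).2]
    exact Part.get_mem hd

/-! ### An optimal prefix-free decompressor -/

theorem complexity_le {α : Type*} [Encodable α] {D : List Bool →. ℕ} {x : α} {p : List Bool}
    (h : encode x ∈ D p) : complexity D x ≤ p.length :=
  iInf₂_le p h

/-- The self-delimiting code `1ᵉ0` of a natural number. -/
def unary (e : ℕ) : List Bool := (List.range e).map (fun _ => true) ++ [false]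

theorem length_unary (e : ℕ) : (unary e).length = e + 1 := by simp [unary]

theorem unary_append_prefix {e e' : ℕ} {p p' : List Bool}
    (h : unary e ++ p <+: unary e' ++ p') : e = e' ∧ p <+: p' := by
  have hu : ∀ e, unary (e + 1) = true :: unary e := by
    intro e
    simp [unary, List.replicate_succ]
  have h0 : unary 0 = [false] := rfl
  induction e generalizing e' with
  | zero =>
    cases e' with
    | zero => simpa [h0] using h
    | succ e' => simp [h0, hu] at h
  | succ e ih =>
    cases e' with
    | zero => simp [h0, hu] at h
    | succ e' =>
      rw [hu, hu, List.cons_append, List.cons_append, List.cons_prefix_cons] at h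
      simpa using ih h.2

theorem primrecRel_forall_lt {α : Type*} [Primcodable α] {R : ℕ → α → Prop}
    (hR : PrimrecRel R) : PrimrecRel fun (n : ℕ) (a : α) => ∀ x < n, R x a :=
  (hR.forall_mem_list.comp (Primrec.list_range.comp .fst) .snd).of_eq (by simp)

theorem primrecRel_exists_lt {α : Type*} [Primcodable α] {R : ℕ → α → Prop}
    (hR : PrimrecRel R) : PrimrecRel fun (n : ℕ) (a : α) => ∃ x < n, R x a :=
  (hR.exists_mem_list.comp (Primrec.list_range.comp .fst) .snd).of_eq (by simp)

/-- The program listed at step `t` is incomparable with those listed earlier. -/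
def IsFresh (c : Code) (t : ℕ) : Prop :=
  ∀ t' < t, ∀ a ∈ (graphEnum c t).toList, ∀ b ∈ (graphEnum c t').toList,
    ¬ (a.1 <+: b.1 ∨ b.1 <+: a.1)

theorem primrecRel_prefix : PrimrecRel fun p q : List Bool => p <+: q := by
  refine PrimrecRel.of_eq (r := fun p q : List Bool => p = q.take p.length) ?_ fun p q =>
    List.prefix_iff_eq_take.symm
  exact (Primrec.eq.comp .fst (Primrec.list_take.comp (Primrec.list_length.comp .fst) .snd))

theorem primrecRel_isFresh : PrimrecRel IsFresh := by
  have hc : PrimrecRel fun (b a : List Bool × ℕ) => ¬ (a.1 <+: b.1 ∨ b.1 <+: a.1) :=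
    (PrimrecPred.or (primrecRel_prefix.comp (Primrec.fst.comp .snd) (Primrec.fst.comp .fst))
      (primrecRel_prefix.comp (Primrec.fst.comp .fst) (Primrec.fst.comp .snd))).not
  have h1 : PrimrecRel fun (a : List Bool × ℕ) (l : List (List Bool × ℕ)) =>
      ∀ b ∈ l, ¬ (a.1 <+: b.1 ∨ b.1 <+: a.1) :=
    hc.forall_mem_list.comp .snd .fst
  have h2 := h1.forall_mem_list
  have hl : Primrec fun a : Code × ℕ => (graphEnum a.1 a.2).toList :=
    Primrec.optionToList.comp (primrec_graphEnum.comp .fst .snd)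
  have h3 : PrimrecRel fun (t' : ℕ) (y : Code × ℕ) => ∀ a ∈ (graphEnum y.1 y.2).toList,
      ∀ b ∈ (graphEnum y.1 t').toList, ¬ (a.1 <+: b.1 ∨ b.1 <+: a.1) :=
    h2.comp (hl.comp .snd) (hl.comp (.pair (Primrec.fst.comp .snd) .fst))
  exact (primrecRel_forall_lt h3).comp .snd (.pair .fst .snd)

open Classical in
/-- Enumeration of the graph of a universal prefix-free machine. -/
noncomputable def universalEnum (i : ℕ) : Option (List Bool × ℕ) :=
  if IsFresh (ofNat Code i.unpair.1) i.unpair.2 then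
    (graphEnum (ofNat Code i.unpair.1) i.unpair.2).map fun a => (unary i.unpair.1 ++ a.1, a.2)
  else none

theorem primrec_unary : Primrec unary :=
  Primrec.list_append.comp (Primrec.list_map .list_range (Primrec.const true).to₂) (.const [false])

theorem primrec_universalEnum : Primrec universalEnum := by
  unfold universalEnum
  have h1 : Primrec fun i : ℕ => i.unpair.1 := Primrec.fst.comp .unpair
  have h2 : Primrec fun i : ℕ => i.unpair.2 := Primrec.snd.comp .unpair
  have hc : Primrec fun i : ℕ => ofNat Code i.unpair.1 := (Primrec.ofNat Code).comp h1
  classical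
  refine Primrec.ite (primrecRel_isFresh.comp hc h2) ?_ (.const none)
  refine Primrec.option_map (primrec_graphEnum.comp hc h2) (.mk (.pair ?_ (Primrec.snd.comp .snd)))
  exact Primrec.list_append.comp ((primrec_unary.comp h1).comp .fst) (Primrec.fst.comp .snd)

theorem universalEnum_eq_some {i n : ℕ} {q : List Bool} (h : universalEnum i = some (q, n)) :
    IsFresh (ofNat Code i.unpair.1) i.unpair.2 ∧
      ∃ p, graphEnum (ofNat Code i.unpair.1) i.unpair.2 = some (p, n) ∧
        unary i.unpair.1 ++ p = q := by
  unfold universalEnum at h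
  split_ifs at h with hf
  obtain ⟨⟨p, m⟩, hp, e⟩ := Option.map_eq_some_iff.1 h
  obtain ⟨rfl, rfl⟩ := Prod.mk.inj e
  exact ⟨hf, p, hp, rfl⟩

/-- Comparable programs carry the same self-delimiting header, hence come from the same code; the
later of two distinct steps would then not be fresh. -/
theorem universalEnum_prefix (i j : ℕ) (p q : List Bool) (n m : ℕ)
    (hi : universalEnum i = some (p, n)) (hj : universalEnum j = some (q, m)) (hpq : p <+: q) :
    i = j := by
  obtain ⟨hfi, p, hp, rfl⟩ := universalEnum_eq_some hi
  obtain ⟨hfj, q, hq, rfl⟩ := universalEnum_eq_some hj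
  obtain ⟨he, hpq⟩ := unary_append_prefix hpq
  have h2 : i.unpair.2 = j.unpair.2 := by
    rw [← he] at hq hfj
    rcases lt_trichotomy i.unpair.2 j.unpair.2 with h | h | h
    · exact absurd (Or.inr hpq) (hfj _ h (q, m) (by simp [hq]) (p, n) (by simp [hp]))
    · exact h
    · exact absurd (Or.inl hpq) (hfi _ h (p, n) (by simp [hp]) (q, m) (by simp [hq]))
  rw [← Nat.pair_unpair i, ← Nat.pair_unpair j, he, h2]

theorem exists_isOptimal : ∃ U, IsOptimal U := by
  obtain ⟨U, hU, hmem⟩ :=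
    exists_isPrefixDecompressor primrec_universalEnum.to_comp universalEnum_prefix
  refine ⟨U, hU, fun D hD => ?_⟩
  obtain ⟨c, hc⟩ := exists_code_of_partrec hD.partrec
  refine ⟨encode c + 1, fun x => ?_⟩
  conv_rhs => unfold complexity
  rw [ENat.iInf_add]
  refine le_iInf fun p => ?_
  by_cases hp : encode x ∈ D p
  swap
  · rw [iInf_neg hp, top_add]
    exact le_top
  rw [iInf_pos hp]
  obtain ⟨t, ht⟩ := exists_graphEnum (c := c) (p := p) (n := x) (by rw [hc]; exact hp)
  -- The filter drops nothing when the machine is already prefix-free: comparable programs coincide,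
  -- and each program is listed only once.
  have hfresh : IsFresh c t := by
    intro t' ht' a ha b hb hab
    rw [Option.mem_toList, ht] at ha
    obtain rfl := Option.some.inj ha
    rw [Option.mem_toList] at hb
    have hdp : (D p).Dom := Part.dom_iff_mem.2 ⟨_, hp⟩
    have hdb : (D b.1).Dom := Part.dom_iff_mem.2 ⟨_, hc b.1 ▸ mem_eval_of_graphEnum hb⟩
    have hpb : b.1 = p := hab.elim (fun h => (hD.prefixFree _ _ hdp hdb h).symm)
      fun h => hD.prefixFree _ _ hdb hdp h
    refine ht'.ne (graphEnum_inj (n := b.2) (p := p) ?_ ht)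
    rw [← hpb]
    exact hb
  have hu : universalEnum (Nat.pair (encode c) t) = some (unary (encode c) ++ p, x) := by
    simp [universalEnum, hfresh, ht]
  refine (complexity_le (x := x) (hmem _ _ _ hu)).trans (le_of_eq ?_)
  rw [List.length_append, length_unary]
  push_cast
  ring

/-! ### The Kraft–Chaitin theorem -/

/-- The big-endian binary expansion of `m` with `L` digits. -/
def bitString (L m : ℕ) : List Bool :=
  (List.range L).map fun j => decide (m / 2 ^ (L - 1 - j) % 2 = 1)

@[simp] theorem length_bitString (L m : ℕ) : (bitString L m).length = L := by simp [bitString]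

theorem primrec_pow : Primrec₂ ((· ^ ·) : ℕ → ℕ → ℕ) := Primrec₂.unpaired'.1 Nat.Primrec.pow

theorem primrec_bitString : Primrec₂ bitString := by
  refine Primrec.list_map (Primrec.list_range.comp .fst)
    (PrimrecRel.decide (PrimrecRel.comp Primrec.eq ?_ (.const 1)))
  refine Primrec.nat_mod.comp (Primrec.nat_div.comp (Primrec.snd.comp .fst) ?_) (.const 2)
  refine primrec_pow.comp (.const 2) (Primrec.nat_sub.comp ?_ .snd)
  exact Primrec.nat_sub.comp (Primrec.fst.comp .fst) (.const 1)

/-- Prefixes of binary expansions correspond to nested dyadic intervals. -/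
theorem div_eq_of_bitString_prefix {L L' m m' : ℕ} (hm : m < 2 ^ L) (hm' : m' < 2 ^ L')
    (h : bitString L m <+: bitString L' m') : L ≤ L' ∧ m' / 2 ^ (L' - L) = m := by
  have hL : L ≤ L' := by simpa using h.length_le
  refine ⟨hL, Nat.eq_of_testBit_eq fun i => ?_⟩
  by_cases hi : i < L
  · have hj : L - 1 - i < (bitString L m).length := by simp; omega
    have := h.getElem hj
    simp only [bitString, List.getElem_map, List.getElem_range] at this
    rw [Nat.testBit_div_two_pow, Nat.testBit_eq_decide_div_mod_eq, Nat.testBit_eq_decide_div_mod_eq]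
    rw [show L - 1 - (L - 1 - i) = i by omega,
      show L' - 1 - (L - 1 - i) = L' - L + i by omega] at this
    rw [this, add_comm]
  -- Beyond the first `L` bits both numbers vanish by their size bounds.
  · have hle : 2 ^ L ≤ 2 ^ i := Nat.pow_le_pow_right two_pos (by omega)
    rw [Nat.testBit_lt_two_pow (hm.trans_le hle), Nat.testBit_lt_two_pow]
    rw [Nat.div_lt_iff_lt_mul (by positivity), ← pow_add]
    exact hm'.trans_le (Nat.pow_le_pow_right two_pos (by omega))

/-- The weight `2⁻ˡ` of a request for a program of length `l`. -/
noncomputable def weight {β : Type*} : Option (ℕ × β) → ℝ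
  | none => 0
  | some a => (1 / 2) ^ a.1

theorem weight_nonneg {β : Type*} (o : Option (ℕ × β)) : 0 ≤ weight o := by
  cases o <;> simp [weight]

/-- `2ˢ` times the weight of a request for a program of length at most `s`. -/
def scaledWeight {β : Type*} (s : ℕ) : Option (ℕ × β) → ℕ
  | none => 0
  | some a => 2 ^ (s - a.1)

/-- Keeps the construction in integer arithmetic, hence primitive recursive; the length bound
prevents truncated subtraction from falsifying the weight. -/
theorem scaledWeight_eq {β : Type*} {s : ℕ} {o : Option (ℕ × β)} (h : ∀ a ∈ o, a.1 ≤ s) :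
    (scaledWeight s o : ℝ) = 2 ^ s * weight o := by
  cases o with
  | none => simp [scaledWeight, weight]
  | some a =>
    have ha := h a rfl
    simp only [scaledWeight, weight]
    push_cast
    rw [pow_sub₀ _ two_ne_zero ha, one_div, inv_pow]

theorem primrec_scaledWeight {β : Type*} [Primcodable β] :
    Primrec₂ (scaledWeight : ℕ → Option (ℕ × β) → ℕ) := by
  have h : Primrec fun a : ℕ × Option (ℕ × β) =>
      (a.2.map fun b => 2 ^ (a.1 - b.1)).getD 0 := by
    refine Primrec.option_getD.comp (Primrec.option_map .snd (.mk ?_)) (.const 0)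
    exact primrec_pow.comp (.const 2)
      (Primrec.nat_sub.comp (Primrec.fst.comp .fst) (Primrec.fst.comp .snd))
  refine h.of_eq fun a => ?_
  obtain ⟨s, _ | a⟩ := a <;> rfl

theorem primrec_sum_range {α : Type*} [Primcodable α] {f : α → ℕ → ℕ} {h : α → ℕ}
    (hf : Primrec₂ f) (hh : Primrec h) : Primrec fun a => ∑ j ∈ Finset.range (h a), f a j := by
  refine (Primrec.nat_rec' (h := fun a (p : ℕ × ℕ) => p.2 + f a p.1) hh (.const 0) (.mk ?_)).of_eq
    fun a => ?_
  · exact Primrec.nat_add.comp (Primrec.snd.comp .snd) (hf.comp .fst (Primrec.fst.comp .snd))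
  · induction h a with
    | zero => rfl
    | succ n ih => rw [Finset.sum_range_succ, ← ih]

/-- The numerator of the left end of the dyadic interval allotted to the `i`-th request. -/
def allotment (r : ℕ → Option (ℕ × ℕ)) (i l : ℕ) : ℕ :=
  ((∑ j ∈ Finset.range i, scaledWeight i (r j)) * 2 ^ (l + 1) + (2 ^ i - 1)) / 2 ^ i

theorem primrec_allotment {r : ℕ → Option (ℕ × ℕ)} (hr : Primrec r) : Primrec₂ (allotment r) := by
  have h1 : Primrec fun a : ℕ × ℕ => ∑ j ∈ Finset.range a.1, scaledWeight a.1 (r j) :=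
    primrec_sum_range (primrec_scaledWeight.comp (Primrec.fst.comp .fst) (hr.comp .snd)) .fst
  have h2 : Primrec fun a : ℕ × ℕ => 2 ^ a.1 := primrec_pow.comp (.const 2) .fst
  exact Primrec.nat_div.comp (Primrec.nat_add.comp (Primrec.nat_mul.comp h1
    (primrec_pow.comp (.const 2) (Primrec.succ.comp .snd))) (Primrec.nat_sub.comp h2 (.const 1))) h2

/-- With S the weight of the earlier requests, the allotment is S·2^(l+1) rounded up. Rounding costs
less than 2^(-l-1) and the interval itself has length 2^(-l-1), so it fits into [S, S + 2^(-l)].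
This rounding is the source of the lost bit. -/
theorem allotment_bounds {r : ℕ → Option (ℕ × ℕ)}
    (hlen : ∀ i a, r i = some a → a.1 ≤ i + 1) (i l : ℕ) :
    ∑ j ∈ Finset.range i, weight (r j) ≤ allotment r i l / 2 ^ (l + 1) ∧
      (allotment r i l + 1) / 2 ^ (l + 1) ≤ ∑ j ∈ Finset.range i, weight (r j) + (1 / 2) ^ l := by
  set S := ∑ j ∈ Finset.range i, weight (r j) with hS
  set N := ∑ j ∈ Finset.range i, scaledWeight i (r j) with hN
  have hNS : (N : ℝ) = 2 ^ i * S := by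
    rw [hN, hS, Finset.mul_sum]
    push_cast
    refine Finset.sum_congr rfl fun j hj => scaledWeight_eq fun a ha => ?_
    exact (hlen j a ha).trans (Finset.mem_range.1 hj)
  have hpos : 0 < 2 ^ i := by positivity
  set m := allotment r i l with hm
  have h1 : N * 2 ^ (l + 1) ≤ m * 2 ^ i := by
    have := Nat.lt_div_mul_add (a := N * 2 ^ (l + 1) + (2 ^ i - 1)) hpos
    simp only [hm, allotment, ← hN]
    omega
  have h2 : m * 2 ^ i ≤ N * 2 ^ (l + 1) + (2 ^ i - 1) := Nat.div_mul_le_self _ _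
  have h2' : m * 2 ^ i + 1 ≤ N * 2 ^ (l + 1) + 2 ^ i := by omega
  have h1' : (2 : ℝ) ^ i * (S * 2 ^ (l + 1)) ≤ 2 ^ i * m := by
    have : (N : ℝ) * 2 ^ (l + 1) ≤ m * 2 ^ i := by exact_mod_cast h1
    rw [hNS] at this
    linarith
  have h2'' : (2 : ℝ) ^ i * m ≤ 2 ^ i * (S * 2 ^ (l + 1) + 1) := by
    have : (m : ℝ) * 2 ^ i + 1 ≤ N * 2 ^ (l + 1) + 2 ^ i := by exact_mod_cast h2'
    rw [hNS] at this
    linarith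
  have hp : (0 : ℝ) < 2 ^ i := by positivity
  have hl : (0 : ℝ) < 2 ^ (l + 1) := by positivity
  constructor
  · rw [le_div_iff₀ hl]
    exact le_of_mul_le_mul_left h1' hp
  · rw [div_le_iff₀ hl]
    have := le_of_mul_le_mul_left h2'' hp
    have e : ((1 : ℝ) / 2) ^ l * 2 ^ (l + 1) = 2 := by
      rw [pow_succ, ← mul_assoc, ← mul_pow]; norm_num
    rw [add_mul, e]
    linarith

/-- The Kraft–Chaitin theorem, with an additive loss of one bit. -/
theorem exists_isPrefixDecompressor_of_requests {r : ℕ → Option (ℕ × ℕ)} (hr : Primrec r)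
    (hlen : ∀ i a, r i = some a → a.1 ≤ i + 1)
    (hsum : ∀ i, ∑ j ∈ Finset.range i, weight (r j) ≤ 1) :
    ∃ D, IsPrefixDecompressor D ∧
      ∀ i l x, r i = some (l, x) → ∃ p : List Bool, p.length = l + 1 ∧ x ∈ D p := by
  let h : ℕ → Option (List Bool × ℕ) := fun i =>
    (r i).map fun a => (bitString (a.1 + 1) (allotment r i a.1), a.2)
  have hh : Primrec h := by
    refine Primrec.option_map hr (.mk (.pair ?_ (Primrec.snd.comp .snd)))
    have hl : Primrec fun a : ℕ × (ℕ × ℕ) => a.2.1 := Primrec.fst.comp .snd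
    exact primrec_bitString.comp (Primrec.succ.comp hl) ((primrec_allotment hr).comp .fst hl)
  have hstep : ∀ {i a}, r i = some a →
      (allotment r i a.1 + 1 : ℝ) / 2 ^ (a.1 + 1) ≤ ∑ j ∈ Finset.range (i + 1), weight (r j) := by
    intro i a ha
    refine (allotment_bounds hlen i a.1).2.trans_eq ?_
    rw [Finset.sum_range_succ, ha, weight]
  have hlt : ∀ {i a}, r i = some a → allotment r i a.1 < 2 ^ (a.1 + 1) := by
    intro i a ha
    have := (hstep ha).trans (hsum _)
    rw [div_le_one (by positivity)] at this
    exact_mod_cast this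
  have hsep : ∀ {i j a b}, r i = some a → r j = some b → i < j →
      (allotment r i a.1 + 1 : ℝ) / 2 ^ (a.1 + 1) ≤ allotment r j b.1 / 2 ^ (b.1 + 1) := by
    intro i j a b ha hb hij
    refine (hstep ha).trans (le_trans ?_ (allotment_bounds hlen j b.1).1)
    exact Finset.sum_le_sum_of_subset_of_nonneg
      (Finset.range_subset_range.2 hij) fun _ _ _ => weight_nonneg _
  obtain ⟨D, hD, hmem⟩ := exists_isPrefixDecompressor (h := h) hh.to_comp (by
    intro i j p q x y hi hj hpq
    obtain ⟨a, ha, e⟩ := Option.map_eq_some_iff.1 hi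
    obtain ⟨b, hb, e'⟩ := Option.map_eq_some_iff.1 hj
    obtain ⟨rfl, -⟩ := Prod.mk.inj e
    obtain ⟨rfl, -⟩ := Prod.mk.inj e'
    -- The prefix relation nests the second interval inside the first, while `hsep` separates the
    -- intervals of distinct requests.
    obtain ⟨hL, hdiv⟩ := div_eq_of_bitString_prefix (hlt ha) (hlt hb) hpq
    set m := allotment r i a.1
    set m' := allotment r j b.1
    obtain ⟨d, hd⟩ := Nat.exists_eq_add_of_le hL
    rw [hd, Nat.add_sub_cancel_left, Nat.div_eq_iff (by positivity)] at hdiv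
    have hb2 : (2 : ℝ) ^ (b.1 + 1) = 2 ^ (a.1 + 1) * 2 ^ d := by rw [hd, pow_add]
    have hlow : (m * 2 ^ d : ℝ) ≤ m' := by exact_mod_cast (by omega : m * 2 ^ d ≤ m')
    have hupp : (m' + 1 : ℝ) ≤ (m + 1) * 2 ^ d := by
      have : 0 < 2 ^ d := by positivity
      have : m' + 1 ≤ (m + 1) * 2 ^ d := by rw [add_mul]; omega
      exact_mod_cast this
    have hA : (0 : ℝ) < 2 ^ (a.1 + 1) := by positivity
    have hd0 : (0 : ℝ) < 2 ^ d := by positivity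
    rcases lt_trichotomy i j with hij | hij | hij
    · have := hsep ha hb hij
      rw [hb2, div_le_div_iff₀ hA (by positivity)] at this
      have : (m + 1 : ℝ) * 2 ^ d ≤ m' := by
        refine le_of_mul_le_mul_left ?_ hA
        linarith
      linarith
    · exact hij
    · have := hsep hb ha hij
      rw [hb2, div_le_div_iff₀ (by positivity) hA] at this
      have : (m' + 1 : ℝ) ≤ m * 2 ^ d := by
        refine le_of_mul_le_mul_left ?_ hA
        linarith
      linarith)
  refine ⟨D, hD, fun i l x hi => ⟨_, length_bitString (l + 1) (allotment r i l), hmem i _ _ ?_⟩⟩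
  simp [h, hi]

/-! ### Kraft's inequality -/

/-- Kraft's inequality for finite prefix-free sets of binary strings. -/
theorem sum_pow_length_le_one (S : Finset (List Bool))
    (hS : ∀ p ∈ S, ∀ q ∈ S, p <+: q → p = q) : ∑ p ∈ S, (1 / 2 : ℝ) ^ p.length ≤ 1 := by
  classical
  have key : ∀ N : ℕ, ∀ S : Finset (List Bool), (∀ p ∈ S, p.length ≤ N) →
      (∀ p ∈ S, ∀ q ∈ S, p <+: q → p = q) → ∑ p ∈ S, (1 / 2 : ℝ) ^ p.length ≤ 1 := by
    intro N
    induction N with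
    | zero =>
      intro S hN _
      have : S ⊆ {[]} := fun p hp => by simpa using hN p hp
      refine (Finset.sum_le_sum_of_subset_of_nonneg this fun _ _ _ => by positivity).trans ?_
      simp
    | succ N ih =>
      intro S hN hS
      by_cases hnil : [] ∈ S
      · have : S ⊆ {[]} := fun p hp => by simpa using (hS [] hnil p hp List.nil_prefix).symm
        refine (Finset.sum_le_sum_of_subset_of_nonneg this fun _ _ _ => by positivity).trans ?_
        simp
      have hinj : ∀ b : Bool, Function.Injective (List.cons b) := fun b => List.cons_injective
      -- Split by the first bit: removing it leaves a prefix-free set of shorter strings, and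
      -- restoring it halves the weight.
      let T : Bool → Finset (List Bool) := fun b => S.preimage (List.cons b) (hinj b).injOn
      have hT : ∀ b, ∑ p ∈ T b, (1 / 2 : ℝ) ^ p.length ≤ 1 := fun b => by
        refine ih (T b) (fun p hp => ?_) fun p hp q hq hpq => ?_
        · simpa using hN _ (Finset.mem_preimage.1 hp)
        · exact hinj b (hS _ (Finset.mem_preimage.1 hp) _ (Finset.mem_preimage.1 hq)
            ((List.prefix_cons_inj b).2 hpq))
      have hsub : S ⊆ (T true).image (List.cons true) ∪ (T false).image (List.cons false) := by
        intro p hp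
        match p, hp with
        | [], hp => exact absurd hp hnil
        | true :: p, hp => simp [T, hp]
        | false :: p, hp => simp [T, hp]
      have himg : ∀ b, ∑ p ∈ (T b).image (List.cons b), (1 / 2 : ℝ) ^ p.length ≤ 1 / 2 := by
        intro b
        rw [Finset.sum_image (hinj b).injOn]
        simp only [List.length_cons, pow_succ, ← Finset.sum_mul]
        linarith [hT b]
      calc ∑ p ∈ S, (1 / 2 : ℝ) ^ p.length
          ≤ ∑ p ∈ (T true).image (List.cons true) ∪ (T false).image (List.cons false),
              (1 / 2 : ℝ) ^ p.length :=
            Finset.sum_le_sum_of_subset_of_nonneg hsub fun _ _ _ => by positivity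
        _ ≤ _ + _ := by
            rw [← Finset.sum_union_inter]
            exact le_add_of_nonneg_right (Finset.sum_nonneg fun _ _ => by positivity)
        _ ≤ 1 / 2 + 1 / 2 := add_le_add (himg true) (himg false)
        _ = 1 := by norm_num
  exact key (S.sup List.length) S (fun p hp => Finset.le_sup (f := List.length) hp) hS

/-! ### Solovay's construction -/

/-- The requests in `g` whose object exceeds `x`. -/
def tail (g : ℕ → Option (ℕ × ℕ)) (x t : ℕ) : Option (ℕ × ℕ) :=
  (g t).bind fun a => if x < a.2 then some a else none

/-- The requirement attended to at step `s`. -/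
def requirement (s : ℕ) : ℕ := s.unpair.1

/-- The number that step `s` may put into the set under construction. -/
def candidate (s : ℕ) : ℕ := s.unpair.2.unpair.1

/-- At step `s`, the candidate is a large element of the computably enumerable set of the current
requirement, and changing its membership is cheap. -/
def Wants (g : ℕ → Option (ℕ × ℕ)) (s : ℕ) : Prop :=
  2 * requirement s ≤ candidate s ∧
  ((ofNat Code (requirement s)).evaln s.unpair.2.unpair.2 (candidate s)).isSome = true ∧
  (∑ t ∈ Finset.range s, scaledWeight s (tail g (candidate s) t)) * 2 ^ (requirement s + 1) ≤ 2 ^ s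

/-- Step `s` puts its candidate into the set; this happens at most once for each requirement. -/
def Acts (g : ℕ → Option (ℕ × ℕ)) (s : ℕ) : Prop :=
  Wants g s ∧ ∀ s' < s, ¬ (requirement s' = requirement s ∧ Wants g s')

/-- The elements put in before step `s`. -/
def stage (g : ℕ → Option (ℕ × ℕ)) (s : ℕ) : Set ℕ :=
  {x | ∃ s' < s, Acts g s' ∧ candidate s' = x}

/-- Solovay's set for the enumeration `g` of pairs (program length, output). -/
def solovaySet (g : ℕ → Option (ℕ × ℕ)) : Set ℕ := {x | ∃ s, Acts g s ∧ candidate s = x}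

/-- The requests for short descriptions of the initial segments of Solovay's set: one at step `t`
for the `t`-th program, and a new one whenever the initial segment changes. -/
noncomputable def request (g : ℕ → Option (ℕ × ℕ)) (i : ℕ) : Option (ℕ × ℕ) :=
  open Classical in
  (g i.unpair.1).bind fun a =>
    if i.unpair.1 = i.unpair.2 ∨
      i.unpair.1 < i.unpair.2 ∧ Acts g i.unpair.2 ∧ candidate i.unpair.2 < a.2 then
      some (a.1 + 1, encode (initialSegment (charSeq (stage g (i.unpair.2 + 1))) a.2))
    else none

/-! ### Effectiveness of the construction -/

theorem primrec_requirement : Primrec requirement := Primrec.fst.comp .unpair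

theorem primrec_candidate : Primrec candidate :=
  Primrec.fst.comp (Primrec.unpair.comp (Primrec.snd.comp .unpair))

theorem primrec_tail {g : ℕ → Option (ℕ × ℕ)} (hg : Primrec g) : Primrec₂ (tail g) := by
  refine Primrec.option_bind (hg.comp .snd) (.mk (Primrec.ite ?_
    (Primrec.option_some.comp .snd) (.const none)))
  exact Primrec.nat_lt.comp (Primrec.fst.comp .fst) (Primrec.snd.comp .snd)

theorem primrecPred_wants {g : ℕ → Option (ℕ × ℕ)} (hg : Primrec g) : PrimrecPred (Wants g) := by
  refine .and ?_ (.and ?_ ?_)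
  · exact Primrec.nat_le.comp (Primrec.nat_mul.comp (.const 2) primrec_requirement)
      primrec_candidate
  · refine Primrec.eq.comp (Primrec.option_isSome.comp (Code.primrec_evaln.comp
      (.pair (.pair ?_ ((Primrec.ofNat Code).comp primrec_requirement)) primrec_candidate)))
      (.const true)
    exact Primrec.snd.comp (Primrec.unpair.comp (Primrec.snd.comp .unpair))
  · have hs : Primrec fun s : ℕ =>
        ∑ t ∈ Finset.range s, scaledWeight s (tail g (candidate s) t) :=
      primrec_sum_range (f := fun s t => scaledWeight s (tail g (candidate s) t))
        (primrec_scaledWeight.comp .fst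
          ((primrec_tail hg).comp (primrec_candidate.comp .fst) .snd)) .id
    exact Primrec.nat_le.comp (Primrec.nat_mul.comp hs
      (primrec_pow.comp (.const 2) (Primrec.succ.comp primrec_requirement)))
      (primrec_pow.comp (.const 2) .id)

theorem primrecPred_acts {g : ℕ → Option (ℕ × ℕ)} (hg : Primrec g) : PrimrecPred (Acts g) := by
  refine (primrecPred_wants hg).and ?_
  have hR : PrimrecRel fun s' s => ¬ (requirement s' = requirement s ∧ Wants g s') :=
    ((Primrec.eq.comp (primrec_requirement.comp .fst) (primrec_requirement.comp .snd)).and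
      ((primrecPred_wants hg).comp .fst)).not
  exact (primrecRel_forall_lt hR).comp .id .id

theorem primrecRel_mem_stage {g : ℕ → Option (ℕ × ℕ)} (hg : Primrec g) :
    PrimrecRel fun s x => x ∈ stage g s := by
  have hR : PrimrecRel fun s' x => Acts g s' ∧ candidate s' = x :=
    ((primrecPred_acts hg).comp .fst).and (Primrec.eq.comp (primrec_candidate.comp .fst) .snd)
  exact primrecRel_exists_lt hR

theorem primrec_request {g : ℕ → Option (ℕ × ℕ)} (hg : Primrec g) : Primrec (request g) := by
  classical
  have h1 : Primrec fun a : ℕ × (ℕ × ℕ) => a.1.unpair.1 :=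
    Primrec.fst.comp (Primrec.unpair.comp .fst)
  have h2 : Primrec fun a : ℕ × (ℕ × ℕ) => a.1.unpair.2 :=
    Primrec.snd.comp (Primrec.unpair.comp .fst)
  have hn : Primrec fun a : ℕ × (ℕ × ℕ) => a.2.2 := Primrec.snd.comp .snd
  have hseg : Primrec₂ fun s n => initialSegment (charSeq (stage g s)) n := by
    refine Primrec.list_map (Primrec.list_range.comp .snd) ?_
    exact PrimrecRel.decide (R := fun (p : ℕ × ℕ) i => i ∈ stage g p.1)
      ((primrecRel_mem_stage hg).comp (Primrec.fst.comp .fst) .snd)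
  refine Primrec.option_bind (hg.comp (Primrec.fst.comp .unpair))
    (.mk (Primrec.ite ?_ ?_ (.const none)))
  · refine (Primrec.eq.comp h1 h2).or ((Primrec.nat_lt.comp h1 h2).and
      (((primrecPred_acts hg).comp h2).and ?_))
    exact Primrec.nat_lt.comp (primrec_candidate.comp h2) hn
  · refine Primrec.option_some.comp (.pair (Primrec.succ.comp (Primrec.fst.comp .snd)) ?_)
    exact Primrec.encode.comp (hseg.comp (Primrec.succ.comp h2) hn)

theorem isEnumerable_solovaySet {g : ℕ → Option (ℕ × ℕ)} (hg : Primrec g) :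
    IsEnumerable (solovaySet g) := by
  classical
  have hR : PrimrecRel fun x s => Acts g s ∧ candidate s = x :=
    ((primrecPred_acts hg).comp .snd).and (Primrec.eq.comp (primrec_candidate.comp .snd) .fst)
  have hp : Partrec₂ fun (x : ℕ) (s : ℕ) => Part.some (decide (Acts g s ∧ candidate s = x)) :=
    hR.decide.to_comp.partrec
  refine (Partrec.rfind hp).dom_re.of_eq fun x => ?_
  refine Nat.rfind_dom.trans (exists_congr fun s => ?_)
  exact ⟨fun h => by simpa using h.1, fun h => ⟨by simpa using h, fun _ => trivial⟩⟩

variable {g : ℕ → Option (ℕ × ℕ)}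

/-! ### Simplicity of the set -/

theorem Acts.eq_of_requirement_eq {s s' : ℕ} (h : Acts g s) (h' : Acts g s')
    (he : requirement s = requirement s') : s = s' := by
  rcases lt_trichotomy s s' with hs | hs | hs
  · exact absurd ⟨he, h.1⟩ (h'.2 _ hs)
  · exact hs
  · exact absurd ⟨he.symm, h'.1⟩ (h.2 _ hs)

/-- Elements below 2k are contributed only by requirements e < k, at most one each, so at least k
numbers below 2k stay outside. Take k one more than the supposed size of the complement. -/
theorem infinite_compl_solovaySet : (solovaySet g)ᶜ.Infinite := by
  classical
  intro hfin
  have hex : ∃ f : ℕ → ℕ, ∀ s, Acts g s → f (requirement s) = candidate s := by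
    refine ⟨fun e => if h : ∃ s, Acts g s ∧ requirement s = e then candidate h.choose else 0,
      fun s hs => ?_⟩
    have h : ∃ s', Acts g s' ∧ requirement s' = requirement s := ⟨s, hs, rfl⟩
    dsimp only
    rw [dif_pos h, h.choose_spec.1.eq_of_requirement_eq hs h.choose_spec.2]
  obtain ⟨f, hf⟩ := hex
  set F := hfin.toFinset
  have hsub : Finset.range (2 * (F.card + 1)) ⊆ F ∪ (Finset.range (F.card + 1)).image f := by
    intro x hx
    rw [Finset.mem_union]
    by_cases hxA : x ∈ solovaySet g
    · obtain ⟨s, hs, rfl⟩ := hxA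
      refine Or.inr (Finset.mem_image.2 ⟨requirement s, ?_, hf s hs⟩)
      have := hs.1.1
      rw [Finset.mem_range] at hx ⊢
      omega
    · exact Or.inl (hfin.mem_toFinset.2 hxA)
  have h1 := Finset.card_le_card hsub
  have h2 := Finset.card_union_le F ((Finset.range (F.card + 1)).image f)
  have h3 := Finset.card_image_le (s := Finset.range (F.card + 1)) (f := f)
  rw [Finset.card_range] at h1 h3
  omega

theorem tail_eq_some {x t : ℕ} {a : ℕ × ℕ} : tail g x t = some a ↔ g t = some a ∧ x < a.2 := by
  rw [tail, Option.bind_eq_some_iff]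
  constructor
  · rintro ⟨b, hb, h⟩
    split_ifs at h with hx
    cases h
    exact ⟨hb, hx⟩
  · rintro ⟨h, hx⟩
    exact ⟨a, h, if_pos hx⟩

theorem weight_tail_le (x t : ℕ) : weight (tail g x t) ≤ weight (g t) := by
  cases h : tail g x t with
  | none => exact weight_nonneg _
  | some a => rw [(tail_eq_some.1 h).1]

/-- The weights form a convergent series: past some `T` less than ε remains, and an `x` at least as
large as every output listed before `T` ignores those earlier pairs. -/
theorem exists_sum_tail_le (hsum : ∀ T, ∑ t ∈ Finset.range T, weight (g t) ≤ 1) {ε : ℝ}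
    (hε : 0 < ε) : ∃ x₀, ∀ x, x₀ ≤ x → ∀ s, ∑ t ∈ Finset.range s, weight (tail g x t) ≤ ε := by
  have hS : Summable fun t => weight (g t) :=
    summable_of_sum_range_le (fun _ => weight_nonneg _) hsum
  obtain ⟨T, hT⟩ := (hS.hasSum.tendsto_sum_nat.eventually
    (lt_mem_nhds (sub_lt_self _ hε))).exists
  refine ⟨(Finset.range T).sup fun t => ((g t).map Prod.snd).getD 0, fun x hx s => ?_⟩
  have hzero : ∀ t < T, tail g x t = none := by
    intro t ht
    rw [Option.eq_none_iff_forall_ne_some]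
    intro a ha
    obtain ⟨hga, hxa⟩ := tail_eq_some.1 ha
    have := (Finset.le_sup (f := fun t => ((g t).map Prod.snd).getD 0)
      (Finset.mem_range.2 ht)).trans hx
    simp only [hga, Option.map_some, Option.getD_some] at this
    omega
  calc ∑ t ∈ Finset.range s, weight (tail g x t)
      ≤ ∑ t ∈ Finset.range (T + s), weight (tail g x t) :=
        Finset.sum_le_sum_of_subset_of_nonneg (Finset.range_subset_range.2 (by omega))
          fun _ _ _ => weight_nonneg _
    _ = ∑ i ∈ Finset.range s, weight (tail g x (T + i)) := by
        rw [Finset.sum_range_add, Finset.sum_eq_zero, zero_add]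
        intro t ht
        rw [hzero t (Finset.mem_range.1 ht), weight]
    _ ≤ ∑ i ∈ Finset.range s, weight (g (T + i)) :=
        Finset.sum_le_sum fun _ _ => weight_tail_le _ _
    _ = ∑ t ∈ Finset.range (T + s), weight (g t) - ∑ t ∈ Finset.range T, weight (g t) := by
        rw [Finset.sum_range_add, add_sub_cancel_left]
    _ ≤ ∑' t, weight (g t) - ∑ t ∈ Finset.range T, weight (g t) :=
        sub_le_sub_right (hS.sum_le_tsum _ fun _ _ => weight_nonneg _) _
    _ ≤ ε := by linarith

/-- Translates the integer test in `Wants` into the real-valued cost bound. -/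
theorem cost_le_iff (hlen : ∀ t a, g t = some a → a.1 ≤ t) (x e s : ℕ) :
    (∑ t ∈ Finset.range s, scaledWeight s (tail g x t)) * 2 ^ (e + 1) ≤ 2 ^ s ↔
      ∑ t ∈ Finset.range s, weight (tail g x t) ≤ (1 / 2) ^ (e + 1) := by
  have h : ((∑ t ∈ Finset.range s, scaledWeight s (tail g x t) : ℕ) : ℝ) =
      2 ^ s * ∑ t ∈ Finset.range s, weight (tail g x t) := by
    rw [Finset.mul_sum]
    push_cast
    refine Finset.sum_congr rfl fun t ht => scaledWeight_eq fun a ha => ?_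
    exact (hlen t a (tail_eq_some.1 ha).1).trans (Finset.mem_range.1 ht).le
  rw [← Nat.cast_le (α := ℝ)]
  push_cast at h ⊢
  rw [h, one_div, inv_pow, ← one_div, le_div_iff₀ (by positivity), mul_assoc]
  exact mul_le_iff_le_one_right (by positivity)

theorem IsEnumerable.exists_code {W : Set ℕ} (hW : IsEnumerable W) :
    ∃ c : Code, ∀ x, x ∈ W ↔ (c.eval x).Dom := by
  have h : Partrec fun x => (Part.assert (x ∈ W) fun _ => Part.some ()).map fun _ => 0 :=
    Partrec.map hW (Computable.const 0).to₂
  obtain ⟨c, hc⟩ := Code.exists_code.1 (Partrec.nat_iff.1 h)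
  refine ⟨c, fun x => ?_⟩
  rw [hc]
  simp [Part.assert]

theorem inter_solovaySet_nonempty (hlen : ∀ t a, g t = some a → a.1 ≤ t)
    (hsum : ∀ T, ∑ t ∈ Finset.range T, weight (g t) ≤ 1) {W : Set ℕ} (hW : IsEnumerable W)
    (hinf : W.Infinite) : (W ∩ solovaySet g).Nonempty := by
  classical
  obtain ⟨c, hc⟩ := hW.exists_code
  obtain ⟨x₀, hx₀⟩ := exists_sum_tail_le hsum
    (show (0 : ℝ) < (1 / 2) ^ (encode c + 1) by positivity)
  obtain ⟨x, hxW, hx⟩ := hinf.exists_gt (max x₀ (2 * encode c))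
  obtain ⟨n, hn⟩ := Part.dom_iff_mem.1 ((hc x).1 hxW)
  obtain ⟨k, hk⟩ := Code.evaln_complete.1 hn
  have hex : ∃ s, requirement s = encode c ∧ Wants g s := by
    refine ⟨Nat.pair (encode c) (Nat.pair x k), by simp [requirement], ?_⟩
    refine ⟨?_, ?_, (cost_le_iff hlen _ _ _).2 ?_⟩
    · simp only [requirement, candidate, Nat.unpair_pair]
      omega
    · simp only [requirement, candidate, Nat.unpair_pair, ofNat_encode]
      exact Option.isSome_iff_exists.2 ⟨n, hk⟩
    · simp only [requirement, candidate, Nat.unpair_pair]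
      exact hx₀ x (by omega) _
  -- The least step wanting to act for this requirement does act. Its candidate need not be `x`, but
  -- it also lies in `W`, by soundness of the bounded evaluation.
  obtain ⟨hreq, hwants⟩ := Nat.find_spec hex
  refine ⟨candidate (Nat.find hex), ?_, _, ⟨hwants, fun s' hs' h => ?_⟩, rfl⟩
  · obtain ⟨m, hm⟩ := Option.isSome_iff_exists.1 hwants.2.1
    rw [hreq, ofNat_encode] at hm
    exact (hc _).2 (Part.dom_iff_mem.2 ⟨m, Code.evaln_sound hm⟩)
  · exact Nat.find_min hex hs' ⟨h.1.trans hreq, h.2⟩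

/-! ### The requests: total weight and adequacy -/

theorem request_eq_some {i : ℕ} {b : ℕ × ℕ} (h : request g i = some b) :
    ∃ a, g i.unpair.1 = some a ∧ b.1 = a.1 + 1 ∧ (i.unpair.1 = i.unpair.2 ∨
      i.unpair.1 < i.unpair.2 ∧ Acts g i.unpair.2 ∧ candidate i.unpair.2 < a.2) := by
  obtain ⟨a, ha, h⟩ := Option.bind_eq_some_iff.1 h
  split_ifs at h with hi
  cases h
  exact ⟨a, ha, rfl, hi⟩

/-- Acting steps have distinct requirements, so the sum is dominated by a geometric series. -/
theorem sum_half_pow_acts_le_one (I : ℕ) [DecidablePred (Acts g)] :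
    ∑ s ∈ Finset.range I, (if Acts g s then (1 / 2 : ℝ) ^ (requirement s + 1) else 0) ≤ 1 := by
  rw [← Finset.sum_filter, ← Finset.sum_image (f := fun e => (1 / 2 : ℝ) ^ (e + 1))]
  · have hgeom : ∀ n : ℕ, ∑ e ∈ Finset.range n, (1 / 2 : ℝ) ^ (e + 1) = 1 - (1 / 2) ^ n := by
      intro n
      induction n with
      | zero => simp
      | succ n ih => rw [Finset.sum_range_succ, ih, pow_succ]; ring
    refine (Finset.sum_le_sum_of_subset_of_nonneg (t := Finset.range I) ?_
      fun _ _ _ => by positivity).trans ?_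
    · intro e he
      obtain ⟨s, hs, rfl⟩ := Finset.mem_image.1 he
      exact Finset.mem_range.2 ((Nat.unpair_left_le s).trans_lt
        (Finset.mem_range.1 (Finset.mem_filter.1 hs).1))
    · rw [hgeom]
      exact sub_le_self _ (by positivity)
  · intro s hs s' hs' he
    exact (Finset.mem_filter.1 hs).2.eq_of_requirement_eq (Finset.mem_filter.1 hs').2 he

theorem sum_weight_request_le_one (hlen : ∀ t a, g t = some a → a.1 ≤ t)
    (hsum : ∀ T, ∑ t ∈ Finset.range T, weight (g t) ≤ 1) (I : ℕ) :
    ∑ i ∈ Finset.range I, weight (request g i) ≤ 1 := by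
  classical
  let F : ℕ × ℕ → ℝ := fun p => weight (request g (Nat.pair p.1 p.2))
  -- The diagonal carries the first requests; the entries t < s carry the repetitions forced by step
  -- `s`. The halves come from the extra bit in `request`.
  have hpoint : ∀ t s, F (t, s) ≤ (if t = s then weight (g t) / 2 else 0) +
      (if t < s then (if Acts g s then weight (tail g (candidate s) t) / 2 else 0) else 0) := by
    intro t s
    have hnn : ∀ o : Option (ℕ × ℕ), 0 ≤ weight o / 2 := fun o => by
      have := weight_nonneg o
      positivity
    cases h : request g (Nat.pair t s) with
    | none =>
      rw [show F (t, s) = 0 by simp only [F, h, weight]]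
      apply add_nonneg <;> split_ifs <;> first | exact hnn _ | exact le_rfl
    | some b =>
      obtain ⟨a, ha, hb, hcase⟩ := request_eq_some h
      rw [Nat.unpair_pair] at ha hcase
      have hF : F (t, s) = (1 / 2) ^ a.1 / 2 := by
        simp only [F, h, weight, hb, pow_succ]
        ring
      dsimp only at ha hcase
      rw [hF]
      rcases hcase with rfl | ⟨hts, hact, hlt⟩
      · simp [ha, weight]
      · rw [if_neg hts.ne, if_pos hts, if_pos hact, tail_eq_some.2 ⟨ha, hlt⟩, weight, zero_add]
  have hcol : ∀ s ∈ Finset.range I, ∑ t ∈ Finset.range I, F (t, s) ≤ weight (g s) / 2 +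
      (if Acts g s then (1 / 2 : ℝ) ^ (requirement s + 1) else 0) / 2 := by
    intro s hs
    refine (Finset.sum_le_sum fun t _ => hpoint t s).trans ?_
    rw [Finset.sum_add_distrib, Finset.sum_ite_eq' _ s, if_pos hs, ← Finset.sum_filter]
    have hfil : (Finset.range I).filter (· < s) = Finset.range s := by
      ext t
      rw [Finset.mem_range] at hs
      simp only [Finset.mem_filter, Finset.mem_range]
      omega
    rw [hfil]
    gcongr
    split_ifs with hact
    · rw [← Finset.sum_div]
      gcongr
      -- The column of an acting step weighs half the cost of its candidate, which the last clause
      -- of `Wants` bounds.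
      exact (cost_le_iff hlen _ _ _).1 hact.1.2.2
    · simp
  calc ∑ i ∈ Finset.range I, weight (request g i)
      = ∑ p ∈ (Finset.range I).image Nat.unpair, F p := by
        rw [Finset.sum_image fun i _ j _ h => by
          rw [← Nat.pair_unpair i, ← Nat.pair_unpair j, h]]
        simp [F]
    _ ≤ ∑ p ∈ Finset.range I ×ˢ Finset.range I, F p := by
        refine Finset.sum_le_sum_of_subset_of_nonneg ?_ fun _ _ _ => weight_nonneg _
        intro p hp
        obtain ⟨i, hi, rfl⟩ := Finset.mem_image.1 hp
        rw [Finset.mem_range] at hi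
        exact Finset.mem_product.2 ⟨Finset.mem_range.2 ((Nat.unpair_left_le i).trans_lt hi),
          Finset.mem_range.2 ((Nat.unpair_right_le i).trans_lt hi)⟩
    _ = ∑ s ∈ Finset.range I, ∑ t ∈ Finset.range I, F (t, s) := Finset.sum_product_right _ _ _
    _ ≤ _ := Finset.sum_le_sum hcol
    _ = (∑ s ∈ Finset.range I, weight (g s)) / 2 + (∑ s ∈ Finset.range I,
          if Acts g s then (1 / 2 : ℝ) ^ (requirement s + 1) else 0) / 2 := by
        rw [Finset.sum_add_distrib, Finset.sum_div, Finset.sum_div]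
    _ ≤ 1 := by linarith [hsum I, sum_half_pow_acts_le_one (g := g) I]

theorem length_request_le (hlen : ∀ t a, g t = some a → a.1 ≤ t) (i : ℕ) (b : ℕ × ℕ)
    (h : request g i = some b) : b.1 ≤ i + 1 := by
  obtain ⟨a, ha, hb, -⟩ := request_eq_some h
  rw [hb]
  exact Nat.succ_le_succ ((hlen _ _ ha).trans (Nat.unpair_left_le i))

theorem initialSegment_congr {A B : Set ℕ} {n : ℕ} (h : ∀ x < n, x ∈ A ↔ x ∈ B) :
    initialSegment (charSeq A) n = initialSegment (charSeq B) n := by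
  refine List.map_congr_left fun x hx => ?_
  exact decide_eq_decide.2 (h x (List.mem_range.1 hx))

theorem mem_stage_succ {s x : ℕ} :
    x ∈ stage g (s + 1) ↔ x ∈ stage g s ∨ Acts g s ∧ candidate s = x := by
  constructor
  · rintro ⟨s', hs', h⟩
    rcases Nat.lt_succ_iff_lt_or_eq.1 hs' with hs | rfl
    · exact Or.inl ⟨s', hs, h⟩
    · exact Or.inr h
  · rintro (⟨s', hs', h⟩ | h)
    · exact ⟨s', hs'.trans s.lt_succ_self, h⟩
    · exact ⟨s, s.lt_succ_self, h⟩

theorem exists_stage_agree (n : ℕ) :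
    ∃ S, ∀ s ≥ S, ∀ x < n, x ∈ stage g s ↔ x ∈ solovaySet g := by
  have hx : ∀ x, ∃ S, ∀ s ≥ S, x ∈ stage g s ↔ x ∈ solovaySet g := by
    intro x
    by_cases h : x ∈ solovaySet g
    · obtain ⟨s, hs⟩ := h
      exact ⟨s + 1, fun s' hs' => ⟨fun _ => ⟨s, hs⟩, fun _ => ⟨s, hs', hs⟩⟩⟩
    · exact ⟨0, fun s _ => ⟨fun ⟨s', _, hs'⟩ => ⟨s', hs'⟩, fun h' => absurd h' h⟩⟩
  choose S hS using hx
  exact ⟨(Finset.range n).sup S, fun s hs x hxn =>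
    hS x s ((Finset.le_sup (Finset.mem_range.2 hxn)).trans hs)⟩

/-- Take the least s ≥ t after which the segment is final. If s = t, the first request already names
it; otherwise step s changed the segment, and so triggered a new request. -/
theorem exists_request {t : ℕ} {a : ℕ × ℕ} (ha : g t = some a) :
    ∃ i, request g i =
      some (a.1 + 1, encode (initialSegment (charSeq (solovaySet g)) a.2)) := by
  classical
  have hex : ∃ s, t ≤ s ∧ initialSegment (charSeq (stage g (s + 1))) a.2 =
      initialSegment (charSeq (solovaySet g)) a.2 := by
    obtain ⟨S, hS⟩ := exists_stage_agree (g := g) a.2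
    exact ⟨max t S, le_max_left _ _, initialSegment_congr (hS _ (by omega))⟩
  obtain ⟨hts, hseg⟩ := Nat.find_spec hex
  set s := Nat.find hex with hs
  refine ⟨Nat.pair t s, ?_⟩
  have hcond : t = s ∨ t < s ∧ Acts g s ∧ candidate s < a.2 := by
    rcases hts.eq_or_lt with h | h
    · exact Or.inl h
    refine Or.inr ⟨h, ?_⟩
    by_contra hno
    obtain ⟨s', hs'⟩ : ∃ s', s = s' + 1 := ⟨s - 1, by omega⟩
    refine Nat.find_min hex (m := s') (by omega) ⟨by omega, ?_⟩
    rw [← hs', ← hseg]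
    refine initialSegment_congr fun x hx => ?_
    rw [mem_stage_succ]
    exact ⟨Or.inl, fun h => h.elim id fun h => absurd ⟨h.1, h.2 ▸ hx⟩ hno⟩
  simp only [request, Nat.unpair_pair, ha, Option.bind_some]
  rw [if_pos hcond, hseg]

/-! ### K-triviality for the optimal machine -/

/-- The pairs (program length, output) enumerated by the code `c`. -/
def lengthEnum (c : Code) (t : ℕ) : Option (ℕ × ℕ) :=
  (graphEnum c t).map fun a => (a.1.length, a.2)

theorem primrec_lengthEnum (c : Code) : Primrec (lengthEnum c) :=
  Primrec.option_map (primrec_graphEnum.comp (.const c) .id)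
    (.mk (.pair (Primrec.list_length.comp (Primrec.fst.comp .snd)) (Primrec.snd.comp .snd)))

theorem length_le_of_lengthEnum (c : Code) (t : ℕ) (a : ℕ × ℕ) (h : lengthEnum c t = some a) :
    a.1 ≤ t := by
  obtain ⟨b, hb, rfl⟩ := Option.map_eq_some_iff.1 h
  exact length_le_of_graphEnum hb

theorem sum_weight_lengthEnum_le_one {U : List Bool →. ℕ} (hU : IsPrefixDecompressor U) {c : Code}
    (hc : ∀ p, c.eval (encode p) = U p) (T : ℕ) :
    ∑ t ∈ Finset.range T, weight (lengthEnum c t) ≤ 1 := by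
  classical
  let P : ℕ → List Bool := fun t => ((graphEnum c t).map Prod.fst).getD []
  let S := (Finset.range T).filter fun t => (graphEnum c t).isSome
  have hP : ∀ t ∈ S, ∃ n, graphEnum c t = some (P t, n) := by
    intro t ht
    obtain ⟨a, ha⟩ := Option.isSome_iff_exists.1 (Finset.mem_filter.1 ht).2
    exact ⟨a.2, by simp [P, ha]⟩
  have hdom : ∀ t ∈ S, (U (P t)).Dom := fun t ht => by
    obtain ⟨n, hn⟩ := hP t ht
    exact Part.dom_iff_mem.2 ⟨n, hc (P t) ▸ mem_eval_of_graphEnum hn⟩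
  have hinj : Set.InjOn P S := by
    intro t ht t' ht' h
    obtain ⟨n, hn⟩ := hP t ht
    obtain ⟨n', hn'⟩ := hP t' ht'
    exact graphEnum_inj (h ▸ hn) hn'
  calc ∑ t ∈ Finset.range T, weight (lengthEnum c t)
      = ∑ t ∈ S, weight (lengthEnum c t) := by
        refine (Finset.sum_subset (Finset.filter_subset _ _) fun t ht hS => ?_).symm
        have : graphEnum c t = none := by
          by_contra hne
          exact hS (Finset.mem_filter.2 ⟨ht, Option.isSome_iff_ne_none.2 hne⟩)
        simp [lengthEnum, this, weight]
    _ = ∑ t ∈ S, (1 / 2 : ℝ) ^ (P t).length := by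
        refine Finset.sum_congr rfl fun t ht => ?_
        obtain ⟨n, hn⟩ := hP t ht
        rw [lengthEnum, hn, Option.map_some, weight]
    _ = ∑ p ∈ S.image P, (1 / 2 : ℝ) ^ p.length :=
        (Finset.sum_image (f := fun p : List Bool => (1 / 2 : ℝ) ^ p.length) hinj).symm
    _ ≤ 1 := by
        refine sum_pow_length_le_one _ fun p hp q hq hpq => ?_
        obtain ⟨t, ht, rfl⟩ := Finset.mem_image.1 hp
        obtain ⟨t', ht', rfl⟩ := Finset.mem_image.1 hq
        exact hU.prefixFree _ _ (hdom t ht) (hdom t' ht') hpq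

/-- The length of a string is at most as complex as the string, up to a constant. -/
theorem IsOptimal.exists_complexity_length_le {U : List Bool →. ℕ} (hU : IsOptimal U) :
    ∃ c : ℕ, ∀ l : List Bool, complexity U l.length ≤ complexity U l + c := by
  have hlen : Primrec fun m : ℕ => ((decode m : Option (List Bool)).map List.length).getD 0 :=
    Primrec.option_getD.comp (Primrec.option_map Primrec.decode
      (Primrec.list_length.comp .snd).to₂) (.const 0)
  let D : List Bool →. ℕ := fun p =>
    (U p).map fun m => ((decode m : Option (List Bool)).map List.length).getD 0
  -- Postcomposition with a total function leaves the domain, and thus prefix-freeness, untouched.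
  have hD : IsPrefixDecompressor D :=
    ⟨hU.isPrefixDecompressor.partrec.map (hlen.to_comp.comp .snd).to₂,
      fun p q hp hq => hU.isPrefixDecompressor.prefixFree p q hp hq⟩
  obtain ⟨c, hc⟩ := hU.le_add D hD
  refine ⟨c, fun l => (hc _).trans ?_⟩
  gcongr
  refine le_iInf₂ fun p hp => complexity_le ?_
  exact (Part.mem_map_iff _).2 ⟨_, hp, by simp⟩

theorem exists_complexity_initialSegment_le {U : List Bool →. ℕ} (hU : IsOptimal U) {c : Code}
    (hc : ∀ p, c.eval (encode p) = U p) : ∃ d : ℕ, ∀ n : ℕ,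
      complexity U (initialSegment (charSeq (solovaySet (lengthEnum c))) n) ≤
        complexity U n + d := by
  have hlen := length_le_of_lengthEnum c
  have hsum := sum_weight_lengthEnum_le_one hU.isPrefixDecompressor hc
  obtain ⟨D, hD, hmem⟩ := exists_isPrefixDecompressor_of_requests
    (primrec_request (primrec_lengthEnum c)) (length_request_le hlen)
    (sum_weight_request_le_one hlen hsum)
  obtain ⟨d, hd⟩ := hU.le_add D hD
  -- One bit is added in `request`, one is lost in Kraft–Chaitin, and `d` compares the resulting
  -- machine with `U`.
  refine ⟨2 + d, fun n => ?_⟩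
  conv_rhs => unfold complexity
  rw [ENat.iInf_add]
  refine le_iInf fun p => ?_
  by_cases hp : encode n ∈ U p
  swap
  · rw [iInf_neg hp, top_add]
    exact le_top
  rw [iInf_pos hp]
  obtain ⟨t, ht⟩ := exists_graphEnum (c := c) (p := p) (n := n) (by rw [hc]; exact hp)
  obtain ⟨i, hi⟩ := exists_request (g := lengthEnum c) (t := t) (a := (p.length, n))
    (by rw [lengthEnum, ht, Option.map_some])
  obtain ⟨q, hq, hqD⟩ := hmem _ _ _ hi
  refine (show _ ≤ _ from hd (encode (initialSegment _ n))).trans ?_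
  refine (add_le_add_left (complexity_le (x := encode (initialSegment _ n)) hqD) _).trans
    (le_of_eq ?_)
  rw [hq]
  push_cast
  ring

end KTriviality

theorem mainTheorem5 :
    ∃ A : Set ℕ, KTriviality.IsEnumerable A ∧ ¬ KTriviality.IsDecidable A ∧
      KTriviality.IsSimple A ∧ KTriviality.IsKTrivial (KTriviality.charSeq A) := by
  obtain ⟨U, hU⟩ := KTriviality.exists_isOptimal
  obtain ⟨c, hc⟩ := KTriviality.exists_code_of_partrec hU.isPrefixDecompressor.partrec
  let A := KTriviality.solovaySet (KTriviality.lengthEnum c)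
  have hA : KTriviality.IsSimple A :=
    ⟨KTriviality.isEnumerable_solovaySet (KTriviality.primrec_lengthEnum c),
      KTriviality.infinite_compl_solovaySet, fun W hW hinf =>
      KTriviality.inter_solovaySet_nonempty (KTriviality.length_le_of_lengthEnum c)
        (KTriviality.sum_weight_lengthEnum_le_one hU.isPrefixDecompressor hc) hW hinf⟩
  refine ⟨A, hA.isEnumerable, fun hdec => ?_, hA, U, hU, ?_⟩
  -- If `A` were decidable, its complement would be an infinite c.e. set, which a simple set must
  -- meet.
  · obtain ⟨x, hx, hxA⟩ := hA.inter_nonempty Aᶜ (ComputablePred.to_re hdec.not) hA.infinite_compl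
    exact hx hxA
  · obtain ⟨d, hd⟩ := KTriviality.exists_complexity_initialSegment_le hU hc
    obtain ⟨e, he⟩ := hU.exists_complexity_length_le
    refine ⟨d + e, fun n => ⟨(hd n).trans ?_, ?_⟩⟩
    · gcongr
      exact_mod_cast Nat.le_add_right d e
    · have h := he (KTriviality.initialSegment (KTriviality.charSeq A) n)
      rw [KTriviality.initialSegment, List.length_map, List.length_range] at h
      refine h.trans ?_
      rw [← KTriviality.initialSegment]
      gcongr
      exact_mod_cast Nat.le_add_left e d
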